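/- Let $G$ be a countable (finite or countably infinite) group. An action of $G$ on a set $X$ is called f.s.o. (finite stabilizers orbits) if for all $x,y\in X$ the orbit $G_x y$ of $y$ under the stabilizer $G_x$ of $x$ is finite, and amenable if there is a $G$-invariant mean on $\ell^\infty(X)$, i.e. a linear functional $m:\ell^\infty(X)\to\mathbb{C}$ that is unital, positive and invariant under the translations $f\mapsto f(g^{-1}\,\cdot\,)$, $g\in G$. A metric on $X$ is locally finite if all its balls are finite. A locally compact group $\mathfrak G$ is amenable if there is a mean (unital positive linear functional) on the bounded continuous functions $C_b(\mathfrak G)$ that is invariant under left translations by $\mathfrak G$. The following are equivalent: (i) $G$ admits a faithful, amenable f.s.o. action on some set; (ii) $G$ admits a faithful, amenable action on some set that preserves a locally finite metric; (iii) $G$ is isomorphic, as an abstract group, to a subgroup of an amenable totally disconnected locally compact (Hausdorff) group. -/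

import Mathlib

universe u v w t

/-- The translate `z ↦ f (g⁻¹ • z)` of a bounded continuous function on a space on which the
group `G` acts by homeomorphisms. -/
noncomputable def translateBCF {G Z : Type*} [Group G] [TopologicalSpace Z] [MulAction G Z]
    [ContinuousConstSMul G Z] (g : G) (f : BoundedContinuousFunction Z ℂ) :
    BoundedContinuousFunction Z ℂ :=
  f.compContinuous ⟨fun z => g⁻¹ • z, continuous_const_smul g⁻¹⟩

open scoped ComplexOrder in
/-- `m` is an invariant mean on `C_b(Z)`: a unital positive linear functional on the bounded
continuous complex-valued functions on `Z` that is invariant under all translations by `G`. -/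
structure IsInvariantMean (G : Type*) {Z : Type*} [Group G] [TopologicalSpace Z] [MulAction G Z]
    [ContinuousConstSMul G Z] (m : BoundedContinuousFunction Z ℂ →ₗ[ℂ] ℂ) : Prop where
  unital : m 1 = 1
  positive : ∀ f : BoundedContinuousFunction Z ℂ, (∀ z, 0 ≤ f z) → 0 ≤ m f
  invariant : ∀ (g : G) (f : BoundedContinuousFunction Z ℂ), m (translateBCF g f) = m f

/-- Amenability in Greenleaf's sense: there is an invariant mean on `C_b(Z)`. -/
def IsTopologicallyAmenable (G Z : Type*) [Group G] [TopologicalSpace Z] [MulAction G Z]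
    [ContinuousConstSMul G Z] : Prop :=
  ∃ m : BoundedContinuousFunction Z ℂ →ₗ[ℂ] ℂ, IsInvariantMean G m

/-- A topological group is amenable if its action on itself by left translations is
topologically amenable. -/
def IsAmenableTopGroup (H : Type*) [Group H] [TopologicalSpace H] [IsTopologicalGroup H] : Prop :=
  IsTopologicallyAmenable H H

/-- An action on a set is amenable if there is an invariant mean on the algebra `ℓ^∞(X)` of all
bounded functions, that is, on `C_b(X)` for the discrete topology on `X`. -/
def IsAmenableAction (G X : Type*) [Group G] [MulAction G X] : Prop :=
  letI : TopologicalSpace X := ⊥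
  haveI : DiscreteTopology X := ⟨rfl⟩
  haveI : ContinuousConstSMul G X := ⟨fun _ => continuous_of_discreteTopology⟩
  IsTopologicallyAmenable G X

/-- An action has finite stabilizers orbits (is f.s.o.) if all orbits of all the point
stabilizers are finite. -/
def IsFSO (G X : Type*) [Group G] [MulAction G X] : Prop :=
  ∀ x y : X, (MulAction.orbit (MulAction.stabilizer G x) y).Finite

/-- The action preserves some locally finite metric, i.e. a metric all of whose balls are
finite. -/
def PreservesLocallyFiniteMetric (G X : Type*) [Group G] [MulAction G X] : Prop :=
  ∃ _ : MetricSpace X,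
    (∀ (g : G) (x y : X), dist (g • x) (g • y) = dist x y) ∧
    ∀ (x : X) (r : ℝ), (Metric.ball x r).Finite

/-- `G` admits a faithful, amenable f.s.o. action on a set. -/
def HasFaithfulAmenableFSOAction.{a, b} (G : Type a) [Group G] : Prop :=
  ∃ (X : Type b) (_ : MulAction G X), FaithfulSMul G X ∧ IsAmenableAction G X ∧ IsFSO G X

/-- `G` admits a faithful, amenable action on a set that preserves a locally finite metric. -/
def HasFaithfulAmenableLocallyFiniteMetricAction.{a, b} (G : Type a) [Group G] : Prop :=
  ∃ (X : Type b) (_ : MulAction G X),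
    FaithfulSMul G X ∧ IsAmenableAction G X ∧ PreservesLocallyFiniteMetric G X

/-- `G` is (isomorphic, as an abstract group, to) a subgroup of an amenable totally disconnected
locally compact Hausdorff group. -/
def IsSubgroupOfAmenableTDLC.{a, b} (G : Type a) [Group G] : Prop :=
  ∃ (H : Type b) (_ : Group H) (_ : TopologicalSpace H) (_ : IsTopologicalGroup H),
    T2Space H ∧ LocallyCompactSpace H ∧ TotallyDisconnectedSpace H ∧ IsAmenableTopGroup H ∧
      ∃ φ : G →* H, Function.Injective φ

/-! From a metric to f.s.o.: the stabilizer of `x` preserves each ball around `x`, and balls are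
finite. From f.s.o. to a tdlc group: let `H` be the closure of `G` in the permutations of `X`
(`permClosure`). The f.s.o. condition says exactly that stabilizers in `H` have finite orbits, so by
Tychonoff they are compact open. The `G`-invariant mean on `X` becomes `H`-invariant after averaging
over orbits of a compact open subgroup (`IsTopologicallyAmenable.of_denseRange`). It lifts to `H`
because Haar averages over the sets carrying an orbit representative to `x` give an equivariant
operator from `C_b(H)` to bounded functions on `X` (`IsTopologicallyAmenable.isAmenableTopGroup`).

From a tdlc group to a metric: by van Dantzig, the group generated by `G` and a compact open
subgroup is open, hence amenable, and covered by countably many compact sets. A countable disjoint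
union of its coset spaces modulo small compact open subgroups is a faithful, amenable, f.s.o.
`G`-set (`exists_countable_faithful_amenable_fso`). Weighting the pairs of points by their `G`-orbit
yields an invariant locally finite path metric. -/

/-! ### Invariant means and equivariant maps -/

section Means

variable {G H Y Z : Type*} [Group G] [Group H] [TopologicalSpace Y] [TopologicalSpace Z]
  [MulAction H Y] [MulAction G Z] [ContinuousConstSMul H Y] [ContinuousConstSMul G Z]

@[simp]
theorem translateBCF_apply (g : G) (f : BoundedContinuousFunction Z ℂ) (z : Z) :
    translateBCF g f z = f (g⁻¹ • z) := rfl

open scoped ComplexOrder in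
/-- Invariant means are transported backwards along unital positive equivariant operators. -/
theorem IsTopologicallyAmenable.transfer (φ : G → H)
    (T : BoundedContinuousFunction Z ℂ →ₗ[ℂ] BoundedContinuousFunction Y ℂ) (hT : T 1 = 1)
    (hpos : ∀ f : BoundedContinuousFunction Z ℂ, (∀ z, 0 ≤ f z) → ∀ y, 0 ≤ T f y)
    (heq : ∀ g f, T (translateBCF g f) = translateBCF (φ g) (T f))
    (h : IsTopologicallyAmenable H Y) : IsTopologicallyAmenable G Z := by
  obtain ⟨m, hm⟩ := h
  refine ⟨m ∘ₗ T, ?_, fun f hf => hm.positive _ (hpos f hf), fun g f => ?_⟩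
  · simp [hT, hm.unital]
  · simp [heq, hm.invariant]

/-- Invariant means are pushed forward along continuous equivariant maps. -/
theorem IsTopologicallyAmenable.map (φ : G → H) (π : C(Y, Z))
    (hπ : ∀ g y, π (φ g • y) = g • π y) (hφ : ∀ g, φ g⁻¹ = (φ g)⁻¹)
    (h : IsTopologicallyAmenable H Y) : IsTopologicallyAmenable G Z := by
  refine h.transfer φ
    { toFun := fun f => f.compContinuous π
      map_add' := fun _ _ => rfl
      map_smul' := fun _ _ => rfl } rfl (fun f hf y => hf _) fun g f => ?_
  ext y
  change f (g⁻¹ • π y) = f (π ((φ g)⁻¹ • y))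
  rw [← hφ, hπ]

theorem isAmenableAction_iff [DiscreteTopology Z] :
    IsAmenableAction G Z ↔ IsTopologicallyAmenable G Z := by
  obtain rfl := DiscreteTopology.eq_bot (α := Z)
  rfl

end Means

theorem IsAmenableAction.map {G X Y : Type*} [Group G] [MulAction G X] [MulAction G Y]
    (h : IsAmenableAction G X) (π : X → Y) (hπ : ∀ (g : G) x, π (g • x) = g • π x) :
    IsAmenableAction G Y := by
  let _ : TopologicalSpace X := ⊥
  have : DiscreteTopology X := ⟨rfl⟩
  have : ContinuousConstSMul G X := ⟨fun _ => continuous_of_discreteTopology⟩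
  let _ : TopologicalSpace Y := ⊥
  have : DiscreteTopology Y := ⟨rfl⟩
  have : ContinuousConstSMul G Y := ⟨fun _ => continuous_of_discreteTopology⟩
  rw [isAmenableAction_iff] at h ⊢
  exact h.map id ⟨π, continuous_of_discreteTopology⟩ hπ fun _ => rfl

theorem IsAmenableAction.nonempty {G X : Type*} [Group G] [MulAction G X]
    (h : IsAmenableAction G X) : Nonempty X := by
  by_contra hX
  rw [not_nonempty_iff] at hX
  let _ : TopologicalSpace X := ⊥
  have : DiscreteTopology X := ⟨rfl⟩
  have : ContinuousConstSMul G X := ⟨fun _ => continuous_of_discreteTopology⟩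
  obtain ⟨m, hm⟩ := isAmenableAction_iff.1 h
  have h1 := hm.unital
  rw [show (1 : BoundedContinuousFunction X ℂ) = 0 from by ext x; exact hX.elim x, map_zero] at h1
  exact zero_ne_one h1

/-- By `hstab`, the stabilizer of `π y` is no larger than that of `y`, so its orbits are contained
in images of finite orbits. -/
theorem IsFSO.map {G X Y : Type*} [Group G] [MulAction G X] [MulAction G Y]
    (h : IsFSO G X) (π : X → Y) (hπ : ∀ (g : G) x, π (g • x) = g • π x)
    (hsurj : Function.Surjective π) (hstab : ∀ (g : G) x, g • π x = π x → g • x = x) :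
    IsFSO G Y := by
  intro y z
  obtain ⟨y, rfl⟩ := hsurj y
  obtain ⟨z, rfl⟩ := hsurj z
  refine ((h y z).image π).subset ?_
  rintro _ ⟨⟨g, hg⟩, rfl⟩
  exact ⟨g • z, ⟨⟨g, hstab g y hg⟩, rfl⟩, hπ g z⟩

theorem FaithfulSMul.map_of_stabilizer {G X Y : Type*} [Group G] [MulAction G X] [MulAction G Y]
    [FaithfulSMul G X] (π : X → Y) (hstab : ∀ (g : G) x, g • π x = π x → g • x = x) :
    FaithfulSMul G Y := by
  refine ⟨fun {a b} hab => ?_⟩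
  refine inv_mul_eq_one.1 (eq_of_smul_eq_smul (α := X) fun x => ?_) |>.symm
  rw [one_smul]
  refine hstab _ _ ?_
  rw [mul_smul, hab, inv_smul_smul]

/-! ### Replacing a set with action by one of bounded size -/

/-- The set of all group elements moving a chosen representative of the orbit of `x` to `x`. -/
noncomputable def orbitCode (G : Type*) {X : Type*} [Group G] [MulAction G X] (x : X) : Set G :=
  {g | g • (Quotient.mk (MulAction.orbitRel G X) x).out = x}

section OrbitCode

open scoped Pointwise

variable {G X : Type*} [Group G] [MulAction G X]

/-- Equivariance holds because `x` and `g • x` share one chosen representative. -/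
theorem mem_orbitCode_smul (g h : G) (x : X) :
    h ∈ orbitCode G (g • x) ↔ g⁻¹ * h ∈ orbitCode G x := by
  have : Quotient.mk (MulAction.orbitRel G X) (g • x) = Quotient.mk _ x :=
    Quotient.sound ⟨g, rfl⟩
  simp only [orbitCode, Set.mem_ofPred_eq, this, mul_smul, inv_smul_eq_iff]

theorem orbitCode_smul (g : G) (x : X) : orbitCode G (g • x) = g • orbitCode G x := by
  ext h
  rw [mem_orbitCode_smul, Set.mem_smul_set_iff_inv_smul_mem, smul_eq_mul]

theorem orbitCode_nonempty (x : X) : (orbitCode G x).Nonempty :=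
  MulAction.mem_orbit_symm.1 (Quotient.mk_out (s := MulAction.orbitRel G X) x)

theorem smul_eq_of_smul_orbitCode_eq {g : G} {x : X} (h : g • orbitCode G x = orbitCode G x) :
    g • x = x := by
  obtain ⟨k, hk⟩ := orbitCode_nonempty (G := G) x
  have hk' := hk
  rw [← h, ← orbitCode_smul, mem_orbitCode_smul] at hk'
  have h1 : (g⁻¹ * k) • _ = x := hk'
  rw [mul_smul, show k • _ = x from hk, inv_smul_eq_iff] at h1
  exact h1.symm

end OrbitCode

/-- Identify points with equal `orbitCode`. The quotient embeds in `Set G`, so its size is bounded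
in terms of `G`. The code is equivariant and determines the stabilizer, so all three properties
descend. -/
theorem HasFaithfulAmenableFSOAction.exists_small.{a, b, c} {G : Type a} [Group G] [Small.{c} G]
    (h : HasFaithfulAmenableFSOAction.{a, b} G) : HasFaithfulAmenableFSOAction.{a, c} G := by
  classical
  obtain ⟨X, _, _, ham, hfso⟩ := h
  let R := Set.range (orbitCode G : X → Set G)
  have : Small.{c, a} R := small_of_injective Subtype.val_injective
  let e : R ≃ Shrink.{c} R := equivShrink R
  let π : X → Shrink.{c} R := fun x => e ⟨orbitCode G x, x, rfl⟩
  have hπs : Function.Surjective π := by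
    intro y
    obtain ⟨⟨_, x, rfl⟩, rfl⟩ := e.surjective y
    exact ⟨x, rfl⟩
  have hπe : ∀ {x y : X}, π x = π y → orbitCode G x = orbitCode G y := fun h =>
    congrArg Subtype.val (e.injective h)
  have hπe' : ∀ {x y : X}, orbitCode G x = orbitCode G y → π x = π y := fun h =>
    congrArg e (Subtype.ext h)
  have hinv := Function.surjInv_eq hπs
  let _ : MulAction G (Shrink.{c} R) :=
    { smul := fun g y => π (g • Function.surjInv hπs y)
      one_smul := fun y => by
        change π ((1 : G) • _) = y
        rw [one_smul, hinv]
      mul_smul := fun g k y => by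
        change π ((g * k) • _) = π (g • Function.surjInv hπs (π (k • Function.surjInv hπs y)))
        refine hπe' ?_
        rw [mul_smul, orbitCode_smul g, orbitCode_smul g, ← hπe (hinv (π _))] }
  have hπ : ∀ (g : G) x, π (g • x) = g • π x := fun g x => by
    change π (g • x) = π (g • Function.surjInv hπs (π x))
    refine hπe' ?_
    rw [orbitCode_smul g, orbitCode_smul g, ← hπe (hinv (π _))]
  have hstab : ∀ (g : G) x, g • π x = π x → g • x = x := fun g x hg => by
    rw [← hπ] at hg
    exact smul_eq_of_smul_orbitCode_eq (by rw [← orbitCode_smul]; exact hπe hg)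
  exact ⟨_, _, .map_of_stabilizer π hstab, ham.map π hπ, hfso.map π hπ hπs hstab⟩

/-! ### Invariant locally finite metrics -/

theorem PreservesLocallyFiniteMetric.isFSO {G X : Type*} [Group G] [MulAction G X]
    (h : PreservesLocallyFiniteMetric G X) : IsFSO G X := by
  obtain ⟨_, hinv, hfin⟩ := h
  intro x y
  refine (hfin x (dist y x + 1)).subset ?_
  rintro _ ⟨⟨g, hg⟩, rfl⟩
  rw [Metric.mem_ball]
  have : dist (g • y) (g • x) = dist y x := hinv g y x
  rw [show g • x = x from hg] at this
  change dist (g • y) x < _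
  linarith

/-- `y` can be reached from `x` by a path of total weight `n`. -/
inductive ReachIn {X : Type*} (w : X → X → ℕ) : ℕ → X → X → Prop
  | refl (x : X) : ReachIn w 0 x x
  | step {n : ℕ} {x y : X} (z : X) : ReachIn w n x y → ReachIn w (n + w y z) x z

namespace ReachIn

variable {X : Type*} {w : X → X → ℕ}

theorem single (x y : X) : ReachIn w (w x y) x y := by
  simpa using (refl (w := w) x).step y

theorem trans {m n : ℕ} {x y z : X} (h : ReachIn w m x y) (h' : ReachIn w n y z) :
    ReachIn w (m + n) x z := by
  induction h' with
  | refl => exact h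
  | step z _ ih => rw [← add_assoc]; exact (ih h).step z

theorem symm (hw : ∀ x y, w x y = w y x) {n : ℕ} {x y : X} (h : ReachIn w n x y) :
    ReachIn w n y x := by
  induction h with
  | refl => exact .refl _
  | step z _ ih =>
    rw [add_comm, hw]
    exact (single _ _).trans ih

theorem eq_of_zero (hw : ∀ x y, 0 < w x y) {n : ℕ} {x y : X} (h : ReachIn w n x y) (hn : n = 0) :
    x = y := by
  induction h with
  | refl => rfl
  | @step n x y z _ _ => have := hw y z; omega

theorem map {f : X → X} (hf : ∀ x y, w (f x) (f y) = w x y) {n : ℕ} {x y : X}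
    (h : ReachIn w n x y) : ReachIn w n (f x) (f y) := by
  induction h with
  | refl => exact .refl _
  | step z _ ih => rw [← hf]; exact ih.step _

theorem finite (hw : ∀ x y, 0 < w x y) (hfin : ∀ x n, {y | w x y ≤ n}.Finite) (x : X) (n : ℕ) :
    {y | ∃ k ≤ n, ReachIn w k x y}.Finite := by
  induction n with
  | zero =>
    refine (Set.finite_singleton x).subset ?_
    rintro y ⟨k, hk, h⟩
    exact (h.eq_of_zero hw (by omega)).symm
  | succ n ih =>
    -- Split off the last edge: its weight is positive and at most `n + 1`, so the rest of the path
    -- has weight at most `n`.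
    refine ((Set.finite_singleton x).union (ih.biUnion fun y _ => hfin y (n + 1))).subset ?_
    rintro z ⟨k, hk, h⟩
    cases h with
    | refl => exact Or.inl rfl
    | @step m _ y _ h =>
      have := hw y z
      exact Or.inr (Set.mem_biUnion (x := y) ⟨m, by omega, h⟩ (by simp; omega))

end ReachIn

/-- An f.s.o. action on a countable set preserves the path metric of a suitable weighting of the
complete graph. -/
theorem IsFSO.preservesLocallyFiniteMetric {G X : Type*} [Group G] [MulAction G X] [Countable X]
    (h : IsFSO G X) : PreservesLocallyFiniteMetric G X := by
  classical
  obtain ⟨e, he⟩ := exists_injective_nat (Quotient (MulAction.orbitRel G (X × X)))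
  let c : X → X → ℕ := fun x y => e (Quotient.mk _ (x, y))
  have hc : ∀ (g : G) x y, c (g • x) (g • y) = c x y := fun g x y =>
    congrArg e (Quotient.sound ⟨g, rfl⟩)
  -- The sum makes the weight symmetric; the `1` makes it positive, so that distinct points are at
  -- distance at least one.
  let w : X → X → ℕ := fun x y => c x y + c y x + 1
  have hwg : ∀ (g : G) x y, w (g • x) (g • y) = w x y := fun g x y => by simp only [w, hc]
  have hsymm : ∀ x y, w x y = w y x := fun x y => by simp only [w]; omega
  have hpos : ∀ x y, 0 < w x y := fun x y => Nat.succ_pos _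
  have hcfin : ∀ x k, {y | c x y = k}.Finite := by
    intro x k
    obtain hE | ⟨y, hy⟩ := {y | c x y = k}.eq_empty_or_nonempty
    · rw [hE]; exact Set.finite_empty
    refine (h x y).subset fun z hz => ?_
    -- Pairs `(x, y)` and `(x, z)` in one orbit differ by an element fixing `x`.
    obtain ⟨g, hg⟩ := Quotient.exact (he ((show c x z = k from hz).trans (Eq.symm hy)))
    have h1 := congrArg Prod.fst hg
    have h2 := congrArg Prod.snd hg
    exact ⟨⟨g, h1⟩, h2⟩
  have hfin : ∀ x n, {y | w x y ≤ n}.Finite := by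
    intro x n
    refine ((Set.finite_Iic n).biUnion fun k _ => hcfin x k).subset fun y hy => ?_
    have hy : w x y ≤ n := hy
    exact Set.mem_biUnion (x := c x y) (by simp only [Set.mem_Iic, w] at hy ⊢; omega) rfl
  let d : X → X → ℕ := fun x y => sInf {n | ReachIn w n x y}
  have hd : ∀ x y, ReachIn w (d x y) x y := fun x y =>
    Nat.sInf_mem (s := {n | ReachIn w n x y}) ⟨_, ReachIn.single x y⟩
  have hdle : ∀ {n x y}, ReachIn w n x y → d x y ≤ n := fun h => Nat.sInf_le h
  refine ⟨{ dist := fun x y => d x y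
            dist_self := fun x => by exact_mod_cast Nat.le_zero.1 (hdle (ReachIn.refl x))
            dist_comm := fun x y => by
              exact_mod_cast le_antisymm (hdle ((hd y x).symm hsymm)) (hdle ((hd x y).symm hsymm))
            dist_triangle := fun x y z => by exact_mod_cast hdle ((hd x y).trans (hd y z))
            eq_of_dist_eq_zero := fun {x y} h =>
              (hd x y).eq_of_zero hpos (by exact_mod_cast h) }, fun g x y => ?_, fun x r => ?_⟩
  · change (d (g • x) (g • y) : ℝ) = d x y
    refine congrArg _ (le_antisymm (hdle ((hd x y).map (hwg g))) (hdle ?_))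
    simpa using (hd (g • x) (g • y)).map (f := fun z => g⁻¹ • z) (hwg g⁻¹)
  · refine (ReachIn.finite hpos hfin x ⌈r⌉₊).subset fun y hy => ?_
    have hy : (d y x : ℝ) < r := hy
    refine ⟨d y x, ?_, (hd y x).symm hsymm⟩
    exact_mod_cast hy.le.trans (Nat.le_ceil r)

/-! ### Compact open subgroups and coset spaces -/

section TDLC

open scoped Pointwise
open Topology

variable {H : Type*} [Group H] [TopologicalSpace H] [IsTopologicalGroup H]

/-- Van Dantzig's theorem. -/
theorem exists_compact_open_subgroup_subset [T2Space H] [LocallyCompactSpace H]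
    [TotallyDisconnectedSpace H] {O : Set H} (hO : O ∈ 𝓝 (1 : H)) :
    ∃ U : Subgroup H, IsOpen (U : Set H) ∧ IsCompact (U : Set H) ∧ (U : Set H) ⊆ O := by
  obtain ⟨K, hK, hKO, hKc⟩ := local_compact_nhds hO
  obtain ⟨W, hW, h1W, hWK⟩ := (loc_compact_Haus_tot_disc_of_zero_dim (H := H)).mem_nhds_iff.1 hK
  have hWc : IsCompact W := hKc.of_isClosed_subset hW.isClosed hWK
  obtain ⟨V, hV, hVW⟩ := compact_open_separated_mul_left hWc hW.isOpen subset_rfl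
  have hsub : (MulAction.stabilizer H W : Set H) ⊆ W := fun g hg => by
    have : g • (1 : H) ∈ g • W := Set.smul_mem_smul_set h1W
    rw [show g • W = W from hg] at this
    simpa using this
  have hopen : IsOpen (MulAction.stabilizer H W : Set H) := by
    refine Subgroup.isOpen_of_mem_nhds _ (g := 1) ?_
    -- Since `V * W ⊆ W`, every `g` with both `g` and `g⁻¹` in `V` satisfies `g • W = W`.
    filter_upwards [hV, inv_mem_nhds_one H hV] with g hg hg'
    have key : ∀ k ∈ V, k • W ⊆ W := fun k hk =>
      (Set.smul_set_subset_iff.2 fun w hw => hVW (Set.mul_mem_mul hk hw))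
    refine (key g hg).antisymm ?_
    rw [Set.subset_smul_set_iff]
    exact key _ hg'
  exact ⟨_, hopen, hWc.of_isClosed_subset (Subgroup.isClosed_of_isOpen _ hopen) hsub,
    hsub.trans (hWK.trans hKO)⟩

/-- An open subgroup of an amenable topological group is amenable. -/
theorem IsAmenableTopGroup.of_isOpen (hH : IsAmenableTopGroup H) (S : Subgroup H)
    (hS : IsOpen (S : Set H)) : IsAmenableTopGroup S := by
  have hcode : ∀ h : H, ∃ s : S, s ∈ orbitCode S h := fun h => orbitCode_nonempty h
  let r : H → H := fun h => (Quotient.mk (MulAction.orbitRel S H) h).out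
  have hr : ∀ (s : S) h, r (s • h) = r h := fun s h =>
    congrArg Quotient.out (Quotient.sound (s := MulAction.orbitRel S H) ⟨s, rfl⟩)
  have hmem : ∀ h, h * (r h)⁻¹ ∈ S := fun h => by
    obtain ⟨s, hs⟩ := hcode h
    have hs : (s : H) * r h = h := hs
    rw [← eq_mul_inv_iff_mul_eq] at hs
    exact hs ▸ s.2
  have hcont : Continuous r := by
    refine IsLocallyConstant.continuous ((IsLocallyConstant.iff_exists_open r).2 fun h => ?_)
    refine ⟨(fun k => k * h⁻¹) ⁻¹' S, hS.preimage (continuous_mul_const _), by simp, fun k hk => ?_⟩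
    rw [← hr ⟨k * h⁻¹, hk⟩ h]
    simp [Subgroup.smul_def]
  -- Choosing representatives of the open cosets `S h` splits `H` as copies of `S`; this
  -- `S`-equivariant projection pushes the mean forward.
  let π : C(H, S) := ⟨fun h => ⟨h * (r h)⁻¹, hmem h⟩, by fun_prop⟩
  refine IsTopologicallyAmenable.map (fun s : S => (s : H)) π (fun s h => ?_) (fun _ => rfl) hH
  refine Subtype.ext ?_
  change (s : H) * h * (r (s • h))⁻¹ = s * (h * (r h)⁻¹)
  rw [hr, mul_assoc]

/-- A compact open subgroup and countably many elements generate a subgroup that is covered by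
countably many compact sets. -/
theorem exists_compact_cover_closure {G : Type*} [Group G] (φ : G →* H) (U : Subgroup H)
    (hU : IsCompact (U : Set H)) : ∃ K : List G → Set H, (∀ l, IsCompact (K l)) ∧
      (Subgroup.closure (Set.range φ ∪ U) : Set H) ⊆ ⋃ l, K l := by
  -- `K [g₁, …, gₙ]` is the product `φ g₁ U φ g₂ U ⋯ φ gₙ U U`.
  let K : List G → Set H := List.foldr (fun g S => φ g • ((U : Set H) * S)) U
  have hK : ∀ g l, K (g :: l) = φ g • ((U : Set H) * K l) := fun _ _ => rfl
  refine ⟨K, fun l => ?_, fun h hh => ?_⟩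
  · induction l with
    | nil => exact hU
    | cons g l ih => exact (hU.mul ih).smul _
  · have step : ∀ g, ∀ u ∈ U, ∀ k ∈ ⋃ l, K l, φ g * (u * k) ∈ ⋃ l, K l := by
      intro g u hu k hk
      obtain ⟨l, hl⟩ := Set.mem_iUnion.1 hk
      refine Set.mem_iUnion.2 ⟨g :: l, ?_⟩
      rw [hK]
      exact Set.smul_mem_smul_set (Set.mul_mem_mul hu hl)
    have step' : ∀ x ∈ Set.range φ ∪ (U : Set H), ∀ k ∈ ⋃ l, K l, x * k ∈ ⋃ l, K l := by
      rintro _ (⟨g, rfl⟩ | hu) k hk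
      · simpa using step g 1 U.one_mem k hk
      · simpa using step 1 _ hu k hk
    induction hh using Subgroup.closure_induction_left with
    | one => exact Set.mem_iUnion.2 ⟨[], U.one_mem⟩
    | mul_left x hx y _ ih => exact step' x hx y ih
    | inv_mul_cancel x hx y _ ih =>
      refine step' _ ?_ y ih
      obtain ⟨g, rfl⟩ | hu := hx
      · exact Or.inl ⟨g⁻¹, map_inv φ g⟩
      · exact Or.inr (U.inv_mem hu)

theorem countable_quotient_of_compact_cover {ι : Type*} [Countable ι] (K : ι → Set H)
    (hK : ∀ i, IsCompact (K i)) (hcov : ⋃ i, K i = Set.univ) (U : Subgroup H)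
    (hU : IsOpen (U : Set H)) : Countable (H ⧸ U) := by
  have := QuotientGroup.discreteTopology hU
  rw [← Set.countable_univ_iff,
    ← Set.image_univ_of_surjective (QuotientGroup.mk_surjective (s := U)), ← hcov,
    Set.image_iUnion]
  exact Set.countable_iUnion fun i =>
    ((hK i).image QuotientGroup.continuous_mk).finite_of_discrete.countable

/-- Orbits of point stabilizers of a coset space modulo compact open subgroups are finite. -/
theorem finite_orbit_stabilizer_sigma_quotient {ι : Type*} (U : ι → Subgroup H)
    (hUo : ∀ i, IsOpen (U i : Set H)) (hUc : ∀ i, IsCompact (U i : Set H))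
    (x y : Σ i, H ⧸ U i) : {z | ∃ h : H, h • x = x ∧ h • y = z}.Finite := by
  obtain ⟨i, a⟩ := x
  obtain ⟨j, b⟩ := y
  obtain ⟨a, rfl⟩ := QuotientGroup.mk_surjective a
  obtain ⟨b, rfl⟩ := QuotientGroup.mk_surjective b
  have := QuotientGroup.discreteTopology (hUo j)
  -- The stabilizer of the coset of `a` is the compact group `a (U i) a⁻¹`, so its orbit in the
  -- discrete space `H ⧸ U j` is finite.
  have hc : Continuous fun u : H => ((a * u * a⁻¹ * b : H) : H ⧸ U j) :=
    QuotientGroup.continuous_mk.comp (by fun_prop)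
  refine (((hUc i).image hc).finite_of_discrete.image (Sigma.mk j)).subset ?_
  rintro _ ⟨h, hx, rfl⟩
  have hx : (Sigma.mk i ((h * a : H) : H ⧸ U i) : Σ i, H ⧸ U i) = ⟨i, a⟩ := hx
  have hx : ((h * a : H) : H ⧸ U i) = a := by simpa using hx
  refine ⟨_, ⟨a⁻¹ * h * a, ?_, rfl⟩, ?_⟩
  · have := (QuotientGroup.eq.1 hx.symm)
    simpa [mul_assoc] using this
  · change _ = (Sigma.mk j ((h * b : H) : H ⧸ U j) : Σ i, H ⧸ U i)
    simp [mul_assoc]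

end TDLC

/-- Passing to the open subgroup `S` keeps amenability and makes all coset spaces by open subgroups
countable. The summand `S ⧸ V g` is there to detect `g ≠ 1`; the mean is supported on the single
summand `S ⧸ V 1`. -/
theorem exists_countable_faithful_amenable_fso.{a, b} {G : Type a} [Group G] [Countable G]
    (h : IsSubgroupOfAmenableTDLC.{a, b} G) : ∃ (X : Type (max a b)) (_ : MulAction G X),
      Countable X ∧ FaithfulSMul G X ∧ IsAmenableAction G X ∧ IsFSO G X := by
  obtain ⟨H₁, _, _, _, _, _, _, ham, φ₁, hφ₁⟩ := h
  obtain ⟨U, hUo, hUc, -⟩ := exists_compact_open_subgroup_subset (H := H₁) Filter.univ_mem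
  obtain ⟨K, hK, hcov⟩ := exists_compact_cover_closure φ₁ U hUc
  let S : Subgroup H₁ := Subgroup.closure (Set.range φ₁ ∪ U)
  have hS : IsOpen (S : Set H₁) :=
    Subgroup.isOpen_mono (fun u hu => Subgroup.subset_closure (Or.inr hu)) hUo
  have hSc := Subgroup.isClosed_of_isOpen S hS
  replace ham := ham.of_isOpen S hS
  let φ : G →* S := φ₁.codRestrict S fun g => Subgroup.subset_closure (Or.inl ⟨g, rfl⟩)
  have hφ : ∀ g, φ g = 1 → g = 1 := fun g hg =>
    (map_eq_one_iff φ₁ hφ₁).1 (congrArg Subtype.val hg)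
  have : LocallyCompactSpace S := hSc.isClosedEmbedding_subtypeVal.locallyCompactSpace
  have hcount : ∀ V : Subgroup S, IsOpen (V : Set S) → Countable (S ⧸ V) := by
    refine countable_quotient_of_compact_cover (fun l => Subtype.val ⁻¹' K l)
      (fun l => hSc.isClosedEmbedding_subtypeVal.isCompact_preimage (hK l)) ?_
    rw [← Set.preimage_iUnion, Set.eq_univ_iff_forall]
    exact fun s => hcov s.2
  have hV : ∀ g : G, ∃ V : Subgroup S, IsOpen (V : Set S) ∧ IsCompact (V : Set S) ∧
      (g ≠ 1 → φ g ∉ V) := by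
    intro g
    by_cases hg : g = 1
    · obtain ⟨V, h1, h2, -⟩ := exists_compact_open_subgroup_subset (H := S) Filter.univ_mem
      exact ⟨V, h1, h2, fun h => (h hg).elim⟩
    · obtain ⟨V, h1, h2, h3⟩ := exists_compact_open_subgroup_subset (H := S)
        (isOpen_compl_singleton.mem_nhds (show (1 : S) ∈ {φ g}ᶜ from fun h => hg (hφ g h.symm)))
      exact ⟨V, h1, h2, fun _ h => h3 h rfl⟩
  choose V hVo hVc hVg using hV
  have := fun g => hcount (V g) (hVo g)
  let _ : MulAction G (Σ g, S ⧸ V g) := MulAction.compHom _ φ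
  have hsmul : ∀ (g : G) (x : Σ g, S ⧸ V g), g • x = φ g • x := fun _ _ => rfl
  refine ⟨Σ g, S ⧸ V g, inferInstance, inferInstance, ⟨fun {g k} hgk => ?_⟩, ?_, fun x y => ?_⟩
  · by_contra hne
    have hne' : k⁻¹ * g ≠ 1 := fun h => hne (inv_mul_eq_one.1 h).symm
    refine hVg _ hne' ?_
    have := hgk ⟨k⁻¹ * g, ((1 : S) : S ⧸ V (k⁻¹ * g))⟩
    have h1 : (Sigma.mk (k⁻¹ * g) ((φ g * 1 : S) : S ⧸ V (k⁻¹ * g)) : Σ g, S ⧸ V g) =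
      ⟨k⁻¹ * g, ((φ k * 1 : S) : S ⧸ V (k⁻¹ * g))⟩ := this
    have h2 : ((φ g * 1 : S) : S ⧸ V (k⁻¹ * g)) = ((φ k * 1 : S) : S ⧸ V (k⁻¹ * g)) := by
      simpa using h1
    simpa using QuotientGroup.eq.1 h2.symm
  · let _ : TopologicalSpace (Σ g, S ⧸ V g) := ⊥
    have : DiscreteTopology (Σ g, S ⧸ V g) := ⟨rfl⟩
    have : ContinuousConstSMul G (Σ g, S ⧸ V g) := ⟨fun _ => continuous_of_discreteTopology⟩
    rw [isAmenableAction_iff]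
    have := QuotientGroup.discreteTopology (hVo 1)
    let π : C(S, Σ g, S ⧸ V g) := ⟨fun s => ⟨1, (s : S ⧸ V 1)⟩,
      (continuous_of_discreteTopology (f := Sigma.mk (β := fun g => S ⧸ V g) 1)).comp
        QuotientGroup.continuous_mk⟩
    exact IsTopologicallyAmenable.map φ π (fun _ _ => rfl) (map_inv φ) ham
  · refine (finite_orbit_stabilizer_sigma_quotient V hVo hVc x y).subset ?_
    rintro _ ⟨⟨g, hg⟩, rfl⟩
    exact ⟨φ g, hg, rfl⟩

theorem IsSubgroupOfAmenableTDLC.hasFaithfulAmenableLocallyFiniteMetricAction.{a, b, c}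
    {G : Type a} [Group G] [Countable G] (h : IsSubgroupOfAmenableTDLC.{a, b} G) :
    HasFaithfulAmenableLocallyFiniteMetricAction.{a, c} G := by
  obtain ⟨X, _, _, hf, ham, hfso⟩ := exists_countable_faithful_amenable_fso h
  have : Small.{c, max a b} X := Countable.toSmall X
  let e : X ≃ Shrink.{c} X := equivShrink X
  let _ : MulAction G (Shrink.{c} X) := e.symm.mulAction G
  have he : ∀ (g : G) x, e (g • x) = g • e x := fun g x => by
    change _ = e (g • e.symm (e x))
    rw [e.symm_apply_apply]
  have hstab : ∀ (g : G) x, g • e x = e x → g • x = x := fun g x h => e.injective ((he g x).trans h)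
  have := e.symm.injective.countable
  exact ⟨Shrink.{c} X, inferInstance, .map_of_stabilizer e hstab, ham.map e he,
    (hfso.map e he e.surjective hstab).preservesLocallyFiniteMetric⟩

/-! ### Averaging over finite orbits -/

section SetAvg

variable {X : Type*}

/-- The average of a function over a finite set. -/
noncomputable def setAvg (S : Set X) (f : X → ℂ) : ℂ :=
  (S.ncard : ℂ)⁻¹ * ∑ᶠ y ∈ S, f y

theorem setAvg_coe_finset (s : Finset X) (f : X → ℂ) :
    setAvg (s : Set X) f = (s.card : ℂ)⁻¹ * ∑ y ∈ s, f y := by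
  rw [setAvg, Set.ncard_coe_finset, finsum_mem_coe_finset]

theorem setAvg_image {Y : Type*} (S : Set Y) (f : X → ℂ) {g : Y → X} (hg : Function.Injective g) :
    setAvg (g '' S) f = setAvg S (f ∘ g) := by
  rw [setAvg, setAvg, Set.ncard_image_of_injective S hg, finsum_mem_image hg.injOn]
  rfl

variable {S : Set X}

theorem setAvg_add (hS : S.Finite) (f g : X → ℂ) :
    setAvg S (f + g) = setAvg S f + setAvg S g := by
  lift S to Finset X using hS
  simp only [setAvg_coe_finset, Pi.add_apply, Finset.sum_add_distrib, mul_add]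

theorem setAvg_smul (hS : S.Finite) (c : ℂ) (f : X → ℂ) :
    setAvg S (c • f) = c • setAvg S f := by
  lift S to Finset X using hS
  simp only [setAvg_coe_finset, Pi.smul_apply, smul_eq_mul, ← Finset.mul_sum]
  ring

theorem setAvg_const (hS : S.Finite) (hne : S.Nonempty) (c : ℂ) : setAvg S (fun _ => c) = c := by
  lift S to Finset X using hS
  have : (S.card : ℂ) ≠ 0 := Nat.cast_ne_zero.2 (Finset.card_ne_zero.2 (by exact_mod_cast hne))
  rw [setAvg_coe_finset, Finset.sum_const, nsmul_eq_mul, inv_mul_cancel_left₀ this]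

open scoped ComplexOrder in
theorem setAvg_nonneg (hS : S.Finite) {f : X → ℂ} (hf : ∀ x, 0 ≤ f x) : 0 ≤ setAvg S f := by
  lift S to Finset X using hS
  rw [setAvg_coe_finset]
  refine mul_nonneg ?_ (Finset.sum_nonneg fun x _ => hf x)
  rw [← Complex.ofReal_natCast, ← Complex.ofReal_inv]
  exact Complex.zero_le_real.2 (by positivity)

theorem norm_setAvg_le (hS : S.Finite) {f : X → ℂ} {C : ℝ} (hC : 0 ≤ C) (hf : ∀ x, ‖f x‖ ≤ C) :
    ‖setAvg S f‖ ≤ C := by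
  lift S to Finset X using hS
  rw [setAvg_coe_finset, norm_mul, norm_inv, Complex.norm_natCast]
  have h1 : ‖∑ y ∈ S, f y‖ ≤ S.card * C := by
    simpa using norm_sum_le_of_le S fun y _ => hf y
  obtain h0 | h0 := Nat.eq_zero_or_pos S.card
  · simpa [h0] using hC
  · rw [inv_mul_le_iff₀ (by exact_mod_cast h0)]
    exact h1

/-- After exchanging sums, `f z` receives the weight `1 / |C z|` once from each of the `|C z|`
points of its class. -/
theorem setAvg_setAvg_of_partition (hS : S.Finite) (C : X → Set X) (hsub : ∀ y ∈ S, C y ⊆ S)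
    (hrefl : ∀ y, y ∈ C y) (heq : ∀ y z, z ∈ C y → C z = C y) (f : X → ℂ) :
    setAvg S (fun y => setAvg (C y) f) = setAvg S f := by
  classical
  have hCf : ∀ y ∈ S, (C y).Finite := fun y hy => hS.subset (hsub y hy)
  lift S to Finset X using hS
  rw [setAvg_coe_finset, setAvg_coe_finset]
  congr 1
  have h1 : ∀ y ∈ S, C y = ((S.filter (· ∈ C y) : Finset X) : Set X) := fun y hy => by
    ext z
    simpa using fun hz => hsub y hy hz
  have h2 : ∀ y ∈ S, setAvg (C y) f = ∑ z ∈ S, if z ∈ C y then ((C y).ncard : ℂ)⁻¹ * f z else 0 :=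
    fun y hy => by
      conv_lhs => rw [h1 y hy, setAvg_coe_finset, ← Set.ncard_coe_finset, ← h1 y hy]
      rw [Finset.mul_sum, Finset.sum_filter]
  rw [Finset.sum_congr rfl h2, Finset.sum_comm]
  refine Finset.sum_congr rfl fun z hz => ?_
  have h3 : ∀ y ∈ S, (if z ∈ C y then ((C y).ncard : ℂ)⁻¹ * f z else 0) =
      if y ∈ C z then ((C z).ncard : ℂ)⁻¹ * f z else 0 := fun y _ => by
    by_cases hzy : z ∈ C y
    · rw [if_pos hzy, heq y z hzy, if_pos (hrefl y)]
    · rw [if_neg hzy, if_neg fun hyz => hzy (heq z y hyz ▸ hrefl z)]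
  rw [Finset.sum_congr rfl h3, ← Finset.sum_filter, Finset.sum_const,
    ← Set.ncard_coe_finset, ← h1 z hz, nsmul_eq_mul, mul_inv_cancel_left₀]
  exact Nat.cast_ne_zero.2 ((Set.ncard_pos (hCf z hz)).2 ⟨z, hrefl z⟩).ne'

end SetAvg

/-- Averages of an invariant kernel over two finite transitive sets agree. -/
theorem average_eq_average_of_pretransitive {U A B : Type*} [Group U] [MulAction U A]
    [MulAction U B] [MulAction.IsPretransitive U A] [MulAction.IsPretransitive U B] [Fintype A]
    [Fintype B] (K : A → B → ℂ) (hK : ∀ (u : U) a b, K (u • a) (u • b) = K a b) (a : A) (b : B) :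
    (Fintype.card A : ℂ)⁻¹ * ∑ a', K a' b = (Fintype.card B : ℂ)⁻¹ * ∑ b', K a b' := by
  have hA : ∀ b', ∑ a', K a' b' = ∑ a', K a' b := fun b' => by
    obtain ⟨u, rfl⟩ := MulAction.exists_smul_eq U b b'
    rw [← Equiv.sum_comp (MulAction.toPerm u)]
    exact Finset.sum_congr rfl fun a' _ => hK u a' b
  have hB : ∀ a', ∑ b', K a' b' = ∑ b', K a b' := fun a' => by
    obtain ⟨u, rfl⟩ := MulAction.exists_smul_eq U a a'
    rw [← Equiv.sum_comp (MulAction.toPerm u)]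
    exact Finset.sum_congr rfl fun b' _ => hK u a b'
  -- Transitivity makes all row sums equal and all column sums equal; sum `K` over `A × B` in both
  -- orders.
  have hsum : (Fintype.card B : ℂ) * ∑ a', K a' b = Fintype.card A * ∑ b', K a b' := by
    have := Finset.sum_comm (s := Finset.univ) (t := Finset.univ) (f := fun a b => K a b)
    simp only [hA, hB, Finset.sum_const, nsmul_eq_mul, Finset.card_univ] at this
    exact this.symm
  have hA0 : (Fintype.card A : ℂ) ≠ 0 := Nat.cast_ne_zero.2 (Fintype.card_pos_iff.2 ⟨a⟩).ne'
  have hB0 : (Fintype.card B : ℂ) ≠ 0 := Nat.cast_ne_zero.2 (Fintype.card_pos_iff.2 ⟨b⟩).ne'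
  field_simp
  linear_combination hsum

section OrbitAvg

variable {H X : Type*} [Group H] [MulAction H X] [TopologicalSpace X] [DiscreteTopology X]

/-- The operator averaging functions over the finite orbits of a subgroup. -/
noncomputable def orbitAvg (U : Subgroup H) (hU : ∀ x : X, (MulAction.orbit U x).Finite) :
    BoundedContinuousFunction X ℂ →ₗ[ℂ] BoundedContinuousFunction X ℂ where
  toFun f := .ofNormedAddCommGroupDiscrete (fun x => setAvg (MulAction.orbit U x) f) ‖f‖
    fun x => norm_setAvg_le (hU x) (norm_nonneg f) f.norm_coe_le_norm
  map_add' f g := by ext x; exact setAvg_add (hU x) f g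
  map_smul' c f := by ext x; exact setAvg_smul (hU x) c f

theorem orbitAvg_apply (U : Subgroup H) (hU : ∀ x : X, (MulAction.orbit U x).Finite)
    (f : BoundedContinuousFunction X ℂ) (x : X) :
    orbitAvg U hU f x = setAvg (MulAction.orbit U x) f := rfl

theorem orbitAvg_smul (U : Subgroup H) (hU : ∀ x : X, (MulAction.orbit U x).Finite)
    (f : BoundedContinuousFunction X ℂ) (u : H) (hu : u ∈ U) (x : X) :
    orbitAvg U hU f (u • x) = orbitAvg U hU f x := by
  rw [orbitAvg_apply, orbitAvg_apply, ← MulAction.orbit_smul (⟨u, hu⟩ : U) x]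
  rfl

theorem orbitAvg_orbitAvg {U W : Subgroup H} (hWU : W ≤ U)
    (hU : ∀ x : X, (MulAction.orbit U x).Finite) (hW : ∀ x : X, (MulAction.orbit W x).Finite)
    (f : BoundedContinuousFunction X ℂ) : orbitAvg U hU (orbitAvg W hW f) = orbitAvg U hU f := by
  ext x
  refine setAvg_setAvg_of_partition (hU x) (fun y => MulAction.orbit W y) ?_
    MulAction.mem_orbit_self (fun y z hz => MulAction.orbit_eq_iff.2 hz) f
  rintro _ ⟨u, rfl⟩ _ ⟨w, rfl⟩
  exact ⟨⟨w, hWU w.2⟩ * u, mul_smul _ _ _⟩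

/-- The average of a `W`-invariant function over `U`-orbits is a finite average of translates. -/
theorem orbitAvg_eq_average_translates [ContinuousConstSMul H X] {U W : Subgroup H}
    (hU : ∀ x : X, (MulAction.orbit U x).Finite) [Fintype (U ⧸ W.subgroupOf U)]
    (f : BoundedContinuousFunction X ℂ) (hf : ∀ w ∈ W, ∀ x, f (w • x) = f x) :
    orbitAvg U hU f = (Fintype.card (U ⧸ W.subgroupOf U) : ℂ)⁻¹ •
      ∑ c : U ⧸ W.subgroupOf U, translateBCF (c.out : H) f := by
  ext x
  have := (hU x).fintype
  -- By `W`-invariance of `f` this kernel does not depend on the coset representatives, hence is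
  -- `U`-invariant.
  let K : (U ⧸ W.subgroupOf U) → MulAction.orbit U x → ℂ := fun c y => f ((c.out : H)⁻¹ • (y : X))
  have hKmk : ∀ (u : U) (y : MulAction.orbit U x), K (u : U ⧸ W.subgroupOf U) y =
      f ((u : H)⁻¹ • (y : X)) := fun u y => by
    obtain ⟨⟨w, hw⟩, h⟩ := QuotientGroup.mk_out_eq_mul (W.subgroupOf U) u
    simp only [K, h, Subgroup.coe_mul, mul_inv_rev, mul_smul]
    exact hf _ (W.inv_mem hw) _
  have key := average_eq_average_of_pretransitive (U := U) K (fun u c y => by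
    obtain ⟨c, rfl⟩ := QuotientGroup.mk_surjective c
    change K ((u * c : U) : U ⧸ W.subgroupOf U) _ = _
    rw [hKmk, hKmk]
    change f (_ • (u : H) • (y : X)) = _
    rw [Subgroup.coe_mul, smul_smul, mul_inv_rev, inv_mul_cancel_right])
    ((1 : U) : U ⧸ W.subgroupOf U) ⟨x, MulAction.mem_orbit_self x⟩
  have h2 : setAvg (MulAction.orbit U x) f = (Fintype.card (MulAction.orbit U x) : ℂ)⁻¹ *
      ∑ y : MulAction.orbit U x, f y := by
    rw [setAvg, ← Nat.card_coe_set_eq, Nat.card_eq_fintype_card,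
      finsum_mem_eq_finite_toFinset_sum _ (hU x)]
    congr 1
    exact Finset.sum_subtype _ (by simp) _
  rw [orbitAvg_apply, h2]
  simp only [hKmk] at key
  simp only [Subgroup.coe_one, inv_one, one_smul] at key
  rw [← key]
  simp [K, BoundedContinuousFunction.sum_apply]

open scoped ComplexOrder in
/-- An action with an invariant mean for a dense subgroup has an invariant mean. -/
theorem IsTopologicallyAmenable.of_denseRange {G : Type*} [Group G] [MulAction G X]
    [TopologicalSpace H] [IsTopologicalGroup H] [ContinuousConstSMul H X]
    [ContinuousConstSMul G X] (φ : G →* H) (hφ : DenseRange φ)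
    (hact : ∀ (g : G) (x : X), φ g • x = g • x) (hcont : ∀ x : X, Continuous fun h : H => h • x)
    (U : Subgroup H) (hUo : IsOpen (U : Set H)) (hUc : IsCompact (U : Set H))
    (h : IsTopologicallyAmenable G X) : IsTopologicallyAmenable H X := by
  classical
  obtain ⟨m, hm⟩ := h
  have horb : ∀ V : Subgroup H, IsCompact (V : Set H) → ∀ x : X, (MulAction.orbit V x).Finite :=
    fun V hV x => (hV.image (hcont x)).finite_of_discrete.subset (by
      rintro _ ⟨v, rfl⟩
      exact ⟨v, v.2, rfl⟩)
  -- The translate of `f` by `h` depends only on the open coset `h W`, which meets the dense image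
  -- of `G`.
  have htrans : ∀ W : Subgroup H, IsOpen (W : Set H) → ∀ f : BoundedContinuousFunction X ℂ,
      (∀ w ∈ W, ∀ x, f (w • x) = f x) → ∀ h : H, m (translateBCF h f) = m f := by
    intro W hW f hf h
    obtain ⟨g, hg⟩ := hφ.exists_mem_open (s := (fun k => h⁻¹ * k) ⁻¹' W)
      (hW.preimage (continuous_const_mul _)) ⟨h, by simp⟩
    rw [← hm.invariant g f]
    congr 1
    ext x
    have h1 := hf _ (W.inv_mem hg) (h⁻¹ • x)
    rw [mul_inv_rev, inv_inv, mul_smul, smul_inv_smul, ← map_inv, hact] at h1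
    exact h1.symm
  have hle : ∀ (V W : Subgroup H) (_ : IsOpen (V : Set H)) (hVc : IsCompact (V : Set H))
      (_ : IsOpen (W : Set H)) (hWc : IsCompact (W : Set H)), W ≤ V → ∀ f,
      m (orbitAvg V (horb V hVc) f) = m (orbitAvg W (horb W hWc) f) := by
    intro V W hVo hVc hWo hWc hWV f
    have : CompactSpace V := isCompact_iff_compactSpace.1 hVc
    have : Finite (V ⧸ W.subgroupOf V) :=
      Subgroup.quotient_finite_of_isOpen _ (hWo.preimage continuous_subtype_val)
    have := Fintype.ofFinite (V ⧸ W.subgroupOf V)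
    have hinv := orbitAvg_smul W (horb W hWc) f
    rw [← orbitAvg_orbitAvg hWV (horb V hVc) (horb W hWc),
      orbitAvg_eq_average_translates (W := W) (horb V hVc) _ hinv, map_smul, map_sum]
    simp only [htrans W hWo _ hinv, Finset.sum_const, Finset.card_univ, nsmul_eq_mul, smul_eq_mul]
    refine inv_mul_cancel_left₀ ?_ _
    exact Nat.cast_ne_zero.2 Fintype.card_ne_zero
  -- The averaged mean does not depend on the subgroup: compare both with the intersection.
  have hindep : ∀ (V W : Subgroup H) (_ : IsOpen (V : Set H)) (hVc : IsCompact (V : Set H))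
      (_ : IsOpen (W : Set H)) (hWc : IsCompact (W : Set H)), ∀ f,
      m (orbitAvg V (horb V hVc) f) = m (orbitAvg W (horb W hWc) f) := by
    intro V W hVo hVc hWo hWc f
    have hio : IsOpen ((V ⊓ W : Subgroup H) : Set H) := hVo.inter hWo
    have hic : IsCompact ((V ⊓ W : Subgroup H) : Set H) :=
      hVc.inter_right (Subgroup.isClosed_of_isOpen W hWo)
    rw [hle V (V ⊓ W) hVo hVc hio hic inf_le_left, hle W (V ⊓ W) hWo hWc hio hic inf_le_right]
  refine ⟨m ∘ₗ orbitAvg U (horb U hUc), ?_, fun f hf => hm.positive _ fun x =>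
    setAvg_nonneg (horb U hUc x) hf, fun h f => ?_⟩
  · rw [LinearMap.comp_apply, ← hm.unital]
    congr 1
    ext x
    exact setAvg_const (horb U hUc x) (MulAction.nonempty_orbit x) 1
  -- Translating by `h` turns averages over orbits of `V = h⁻¹ U h` into averages over orbits of
  -- `U`.
  · let V : Subgroup H := U.comap (MulAut.conj h).toMonoidHom
    have hVo : IsOpen (V : Set H) :=
      hUo.preimage (show Continuous fun v => h * v * h⁻¹ by fun_prop)
    have hVc : IsCompact (V : Set H) := by
      refine (hUc.image (show Continuous fun u => h⁻¹ * u * h by fun_prop)).of_isClosed_subset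
        (Subgroup.isClosed_of_isOpen V hVo) fun v hv => ⟨h * v * h⁻¹, hv, by simp [mul_assoc]⟩
    rw [LinearMap.comp_apply, LinearMap.comp_apply, hindep U V hUo hUc hVo hVc f,
      ← htrans V hVo _ (orbitAvg_smul V (horb V hVc) f) h]
    congr 1
    ext x
    rw [orbitAvg_apply, translateBCF_apply, orbitAvg_apply]
    have : MulAction.orbit V (h⁻¹ • x) = (fun y => h⁻¹ • y) '' MulAction.orbit U x := by
      ext y
      constructor
      · rintro ⟨⟨v, hv⟩, rfl⟩
        exact ⟨_, ⟨⟨h * v * h⁻¹, hv⟩, rfl⟩, by simp [Subgroup.smul_def, mul_smul]⟩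
      · rintro ⟨_, ⟨⟨u, hu⟩, rfl⟩, rfl⟩
        exact ⟨⟨h⁻¹ * u * h, by simpa [V, mul_assoc] using hu⟩, by
          simp [Subgroup.smul_def, mul_smul]⟩
    rw [this, setAvg_image _ _ (MulAction.injective h⁻¹)]
    rfl

end OrbitAvg

/-! ### Lifting a mean to the group by Haar averages -/

section Haar

open MeasureTheory

variable {H X : Type*} [Group H] [TopologicalSpace H] [IsTopologicalGroup H] [LocallyCompactSpace H]
  [MulAction H X] [TopologicalSpace X] [DiscreteTopology X] [ContinuousConstSMul H X]

open scoped ComplexOrder in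
/-- A locally compact group is amenable if it has an amenable action with compact open
stabilizers. -/
theorem IsTopologicallyAmenable.isAmenableTopGroup (hcont : ∀ x : X, Continuous fun h : H => h • x)
    (hcomp : ∀ x : X, IsCompact (MulAction.stabilizer H x : Set H))
    (h : IsTopologicallyAmenable H X) : IsAmenableTopGroup H := by
  let _ : MeasurableSpace H := borel H
  have : BorelSpace H := ⟨rfl⟩
  let μ : Measure H := Measure.haar
  -- Each `C x` is a left coset of a compact open stabilizer, so its Haar measure is positive and
  -- finite. As `C (g • x) = g • C x`, left invariance makes the averages equivariant.
  let C : X → Set H := orbitCode H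
  have hCo : ∀ x, IsOpen (C x) := fun x =>
    (isOpen_discrete {x}).preimage (hcont (Quotient.mk (MulAction.orbitRel H X) x).out)
  have hCm : ∀ x, MeasurableSet (C x) := fun x => (hCo x).measurableSet
  have hCc : ∀ x, IsCompact (C x) := fun x => by
    obtain ⟨k, hk⟩ := orbitCode_nonempty (G := H) x
    refine ((hcomp (Quotient.mk (MulAction.orbitRel H X) x).out).image (continuous_const_mul
      k)).of_isClosed_subset
      ((isClosed_discrete {x}).preimage (hcont (Quotient.mk (MulAction.orbitRel H X) x).out))
      fun l hl => ⟨k⁻¹ * l, ?_, by simp⟩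
    change (k⁻¹ * l) • _ = _
    rw [mul_smul, show l • _ = x from hl, inv_smul_eq_iff]
    exact hk.symm
  have hC0 : ∀ x, μ (C x) ≠ 0 := fun x => ((hCo x).measure_pos μ (orbitCode_nonempty x)).ne'
  have hCt : ∀ x, μ (C x) ≠ ⊤ := fun x => (hCc x).measure_ne_top
  have hint : ∀ (f : BoundedContinuousFunction H ℂ) x, IntegrableOn f (C x) μ := fun f x =>
    f.continuous.continuousOn.integrableOn_compact' (hCc x) (hCm x)
  have hshift : ∀ (g : H) (f : H → ℂ) x,
      ∫ k in C x, f (g⁻¹ * k) ∂μ = ∫ k in C (g⁻¹ • x), f k ∂μ := fun g f x => by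
    rw [← integral_indicator (hCm _), ← integral_indicator (hCm _),
      ← integral_mul_left_eq_self ((C (g⁻¹ • x)).indicator f) g⁻¹]
    refine integral_congr_ae (.of_forall fun k => ?_)
    have : k ∈ C x ↔ g⁻¹ * k ∈ C (g⁻¹ • x) := by
      rw [mem_orbitCode_smul, inv_inv, mul_inv_cancel_left]
    by_cases hk : k ∈ C x
    · simp [Set.indicator, hk, this.1 hk]
    · simp [Set.indicator, hk, mt this.2 hk]
  have hmeas : ∀ (g : H) x, μ.real (C (g⁻¹ • x)) = μ.real (C x) := fun g x => by
    rw [measureReal_def, measureReal_def, ← measure_preimage_mul μ g⁻¹ (C (g⁻¹ • x))]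
    congr 2
    ext k
    rw [Set.mem_preimage, mem_orbitCode_smul, inv_inv, mul_inv_cancel_left]
  let T : BoundedContinuousFunction H ℂ →ₗ[ℂ] BoundedContinuousFunction X ℂ :=
    { toFun := fun f => .ofNormedAddCommGroupDiscrete (fun x => ⨍ k in C x, f k ∂μ) ‖f‖ fun x => by
        have hpos : 0 < μ.real (C x) := ENNReal.toReal_pos (hC0 x) (hCt x)
        rw [setAverage_eq, norm_smul, norm_inv, Real.norm_of_nonneg hpos.le,
          inv_mul_le_iff₀ hpos, mul_comm]
        exact norm_setIntegral_le_of_norm_le_const (hCt x).lt_top fun k _ => f.norm_coe_le_norm k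
      map_add' := fun f g => by
        ext x
        change ⨍ k in C x, (f k + g k) ∂μ = (⨍ k in C x, f k ∂μ) + ⨍ k in C x, g k ∂μ
        rw [setAverage_eq, setAverage_eq, setAverage_eq, integral_add (hint f x) (hint g x),
          smul_add]
      map_smul' := fun c f => by
        ext x
        change ⨍ k in C x, c • f k ∂μ = c • ⨍ k in C x, f k ∂μ
        rw [setAverage_eq, setAverage_eq, integral_smul, smul_comm] }
  refine h.transfer id T ?_ (fun f hf x => ?_) fun g f => ?_
  · ext x
    exact setAverage_const (hC0 x) (hCt x) 1
  · change 0 ≤ ⨍ k in C x, f k ∂μ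
    rw [setAverage_eq]
    exact smul_nonneg (by positivity) (integral_nonneg hf)
  · ext x
    change ⨍ k in C x, f (g⁻¹ * k) ∂μ = ⨍ k in C (g⁻¹ • x), f k ∂μ
    rw [setAverage_eq, setAverage_eq, hmeas, hshift g f x]

end Haar

/-! ### The closure of `G` in the permutation group -/

section PermClosure

variable (G X : Type*) [Group G] [MulAction G X]

/-- The closure of the image of `G` in the group of permutations of `X`, for the topology of
pointwise convergence. -/
def permClosure : Subgroup (Equiv.Perm X) where
  carrier := {σ | ∀ F : Finset X, ∃ g : G, ∀ x ∈ F, g • x = σ x}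
  one_mem' F := ⟨1, fun x _ => one_smul G x⟩
  mul_mem' {σ τ} hσ hτ F := by
    classical
    obtain ⟨g, hg⟩ := hτ F
    obtain ⟨k, hk⟩ := hσ (F.image τ)
    exact ⟨k * g, fun x hx => by
      rw [mul_smul, hg x hx, hk _ (Finset.mem_image_of_mem τ hx), Equiv.Perm.mul_apply]⟩
  inv_mem' {σ} hσ F := by
    classical
    obtain ⟨g, hg⟩ := hσ (F.image ⇑σ⁻¹)
    refine ⟨g⁻¹, fun x hx => ?_⟩
    rw [inv_smul_eq_iff, hg _ (Finset.mem_image_of_mem _ hx)]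
    exact (σ.apply_symm_apply x).symm

namespace permClosure

variable {G X}

theorem exists_smul_eq (σ : permClosure G X) (F : Finset X) : ∃ g : G, ∀ x ∈ F, g • x = σ • x :=
  σ.2 F

/-- A permutation together with its inverse, as a pair of functions. -/
def toFunProd (σ : permClosure G X) : (X → X) × (X → X) :=
  (fun x => σ • x, fun x => σ⁻¹ • x)

theorem toFunProd_injective : Function.Injective (toFunProd (G := G) (X := X)) := fun _ _ h =>
  Subtype.ext (Equiv.ext fun x => congrFun (congrArg Prod.fst h) x)

variable (G X) in
/-- The map from `G` to the closure of its image. -/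
def ofGroup : G →* permClosure G X :=
  (MulAction.toPermHom G X).codRestrict _ fun g _ => ⟨g, fun _ _ => rfl⟩

theorem ofGroup_smul (g : G) (x : X) : ofGroup G X g • x = g • x := rfl

theorem ofGroup_injective [FaithfulSMul G X] : Function.Injective (ofGroup G X) := fun g k h =>
  eq_of_smul_eq_smul fun x : X => by rw [← ofGroup_smul, h, ofGroup_smul]

variable [TopologicalSpace X]

/-- Recording inverses makes inversion continuous and the range of `toFunProd` closed; a pointwise
limit of permutations alone need not be surjective. -/
instance : TopologicalSpace (permClosure G X) := .induced toFunProd inferInstance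

theorem isEmbedding_toFunProd : Topology.IsEmbedding (toFunProd (G := G) (X := X)) :=
  ⟨⟨rfl⟩, toFunProd_injective⟩

theorem continuous_smul_const (x : X) : Continuous fun σ : permClosure G X => σ • x :=
  (continuous_apply x).comp (continuous_fst.comp isEmbedding_toFunProd.continuous)

theorem continuous_inv_smul_const (x : X) : Continuous fun σ : permClosure G X => σ⁻¹ • x :=
  (continuous_apply x).comp (continuous_snd.comp isEmbedding_toFunProd.continuous)

theorem denseRange_ofGroup : DenseRange (ofGroup G X) := by
  classical
  rw [DenseRange, dense_iff_inter_open]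
  rintro _ ⟨O, hO, rfl⟩ ⟨σ, hσ⟩
  obtain ⟨u, v, hu, hv, hσu, hσv, huv⟩ := isOpen_prod_iff.1 hO _ _ hσ
  obtain ⟨I, a, ha, haI⟩ := isOpen_pi_iff.1 hu _ hσu
  obtain ⟨J, b, hb, hbJ⟩ := isOpen_pi_iff.1 hv _ hσv
  obtain ⟨g, hg⟩ := exists_smul_eq σ (I ∪ J.image fun x => σ⁻¹ • x)
  refine ⟨ofGroup G X g, huv ⟨haI fun x hx => ?_, hbJ fun x hx => ?_⟩, g, rfl⟩
  · change g • x ∈ a x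
    rw [hg x (Finset.mem_union_left _ hx)]
    exact (ha x hx).2
  · change g⁻¹ • x ∈ b x
    have := hg _ (Finset.mem_union_right _ (Finset.mem_image_of_mem _ hx))
    rw [smul_inv_smul] at this
    rw [inv_smul_eq_iff.2 this.symm]
    exact (hb x hx).2

variable [DiscreteTopology X]

instance : T2Space (permClosure G X) := isEmbedding_toFunProd.t2Space

instance : TotallyDisconnectedSpace (permClosure G X) := by
  rw [← isEmbedding_toFunProd.isTotallyDisconnected_range]
  exact isTotallyDisconnected_of_totallyDisconnectedSpace _

instance : ContinuousSMul (permClosure G X) X :=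
  ⟨continuous_prod_of_discrete_right.2 continuous_smul_const⟩

instance : IsTopologicalGroup (permClosure G X) where
  continuous_mul := by
    rw [isEmbedding_toFunProd.continuous_iff]
    refine (continuous_pi fun x => ?_).prodMk (continuous_pi fun x => ?_)
    · change Continuous fun p : permClosure G X × permClosure G X => (p.1 * p.2) • x
      simp only [mul_smul]
      exact continuous_fst.smul ((continuous_smul_const x).comp continuous_snd)
    · change Continuous fun p : permClosure G X × permClosure G X => (p.1 * p.2)⁻¹ • x
      simp only [mul_inv_rev, mul_smul]
      have h1 : Continuous fun p : permClosure G X × X => p.1⁻¹ • p.2 :=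
        continuous_prod_of_discrete_right.2 continuous_inv_smul_const
      exact h1.comp (continuous_snd.prodMk ((continuous_inv_smul_const x).comp continuous_fst))
  continuous_inv := by
    rw [isEmbedding_toFunProd.continuous_iff]
    refine (continuous_pi continuous_inv_smul_const).prodMk (continuous_pi fun x => ?_)
    change Continuous fun p : permClosure G X => p⁻¹⁻¹ • x
    simp only [inv_inv]
    exact continuous_smul_const x

theorem isOpen_stabilizer (x : X) :
    IsOpen (MulAction.stabilizer (permClosure G X) x : Set (permClosure G X)) :=
  (isOpen_discrete {x}).preimage (continuous_smul_const x)

theorem isClosed_range_toFunProd : IsClosed (Set.range (toFunProd (G := G) (X := X))) := by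
  have : Set.range (toFunProd (G := G) (X := X)) =
      ((⋂ y, {p | p.2 (p.1 y) = y}) ∩ ⋂ y, {p | p.1 (p.2 y) = y}) ∩
        ⋂ F : Finset X, {p | ∃ g : G, ∀ y ∈ F, g • y = p.1 y} := by
    ext p
    simp only [Set.mem_inter_iff, Set.mem_iInter, Set.mem_range]
    constructor
    · rintro ⟨σ, rfl⟩
      exact ⟨⟨inv_smul_smul σ, smul_inv_smul σ⟩, exists_smul_eq σ⟩
    · rintro ⟨⟨h1, h2⟩, h3⟩
      exact ⟨⟨⟨p.1, p.2, h1, h2⟩, h3⟩, rfl⟩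
  have hev : Continuous fun q : (X → X) × X => q.1 q.2 :=
    continuous_prod_of_discrete_right.2 continuous_apply
  rw [this]
  refine ((isClosed_iInter fun y => ?_).inter (isClosed_iInter fun y => ?_)).inter
    (isClosed_iInter fun F => ?_)
  · exact isClosed_eq (hev.comp (continuous_snd.prodMk ((continuous_apply y).comp continuous_fst)))
      continuous_const
  · exact isClosed_eq (hev.comp (continuous_fst.prodMk ((continuous_apply y).comp continuous_snd)))
      continuous_const
  -- The condition involves finitely many coordinates, so it is pulled back from a discrete space.
  · have hr : Continuous fun p : (X → X) × (X → X) => fun y : F => p.1 y := by fun_prop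
    convert (isClosed_discrete {q : F → X | ∃ g : G, ∀ y : F, g • (y : X) = q y}).preimage hr
    simp

/-- An element fixing `x` agrees at `x` and `y` with some `g` in `G`, so it moves `y` within a
finite orbit of the stabilizer of `x` in `G`. The same holds for its inverse, and Tychonoff applies.
-/
theorem isCompact_stabilizer (h : IsFSO G X) (x : X) :
    IsCompact (MulAction.stabilizer (permClosure G X) x : Set (permClosure G X)) := by
  classical
  have hemb : Topology.IsClosedEmbedding (toFunProd (G := G) (X := X)) :=
    ⟨isEmbedding_toFunProd, isClosed_range_toFunProd⟩
  have hP := isCompact_univ_pi fun y => (h x y).isCompact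
  have hmem : ∀ σ ∈ MulAction.stabilizer (permClosure G X) x, ∀ y,
      σ • y ∈ MulAction.orbit (MulAction.stabilizer G x) y := fun σ hσ y => by
    obtain ⟨g, hg⟩ := exists_smul_eq σ {x, y}
    exact ⟨⟨g, (hg x (by simp)).trans hσ⟩, hg y (by simp)⟩
  exact (hemb.isCompact_preimage (hP.prod hP)).of_isClosed_subset
    (Subgroup.isClosed_of_isOpen _ (isOpen_stabilizer x)) fun σ hσ =>
      ⟨fun y _ => hmem σ hσ y, fun y _ => hmem σ⁻¹ (inv_mem hσ) y⟩

end permClosure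

end PermClosure

/-! ### The equivalences -/

theorem HasFaithfulAmenableFSOAction.isSubgroupOfAmenableTDLC.{a, b, c} {G : Type a} [Group G]
    [Small.{c} G] (h : HasFaithfulAmenableFSOAction.{a, b} G) :
    IsSubgroupOfAmenableTDLC.{a, c} G := by
  -- `permClosure G X` lives in the universe of `X`, which must therefore be moved to the target
  -- universe.
  obtain ⟨X, _, _, ham, hfso⟩ := h.exists_small
  let _ : TopologicalSpace X := ⊥
  have : DiscreteTopology X := ⟨rfl⟩
  have : ContinuousConstSMul G X := ⟨fun _ => continuous_of_discreteTopology⟩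
  obtain ⟨x⟩ := ham.nonempty
  have hc := permClosure.isCompact_stabilizer hfso
  have ho := permClosure.isOpen_stabilizer (G := G) x
  have : LocallyCompactSpace (permClosure G X) :=
    (hc x).locallyCompactSpace_of_mem_nhds_of_group (ho.mem_nhds (one_mem _))
  have h1 : IsTopologicallyAmenable (permClosure G X) X :=
    (isAmenableAction_iff.1 ham).of_denseRange (permClosure.ofGroup G X)
      permClosure.denseRange_ofGroup permClosure.ofGroup_smul permClosure.continuous_smul_const
      _ ho (hc x)
  exact ⟨permClosure G X, inferInstance, inferInstance, inferInstance, inferInstance, inferInstance,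
    inferInstance, h1.isAmenableTopGroup permClosure.continuous_smul_const hc,
    permClosure.ofGroup G X, permClosure.ofGroup_injective⟩

theorem HasFaithfulAmenableLocallyFiniteMetricAction.hasFaithfulAmenableFSOAction.{a, b}
    {G : Type a} [Group G] (h : HasFaithfulAmenableLocallyFiniteMetricAction.{a, b} G) :
    HasFaithfulAmenableFSOAction.{a, b} G := by
  obtain ⟨X, _, hf, ham, hm⟩ := h
  exact ⟨X, _, hf, ham, hm.isFSO⟩

theorem mainTheorem2 (G : Type u) [Group G] [Countable G] :
    (HasFaithfulAmenableFSOAction.{u, v} G ↔ IsSubgroupOfAmenableTDLC.{u, w} G) ∧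
    (HasFaithfulAmenableLocallyFiniteMetricAction.{u, t} G ↔
      IsSubgroupOfAmenableTDLC.{u, w} G) := by
  have := Countable.toSmall.{w} G
  exact ⟨⟨fun h => h.isSubgroupOfAmenableTDLC, fun h =>
      h.hasFaithfulAmenableLocallyFiniteMetricAction.hasFaithfulAmenableFSOAction⟩,
    fun h => h.hasFaithfulAmenableFSOAction.isSubgroupOfAmenableTDLC, fun h =>
      h.hasFaithfulAmenableLocallyFiniteMetricAction⟩
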